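/- Two base stations operate over slots $t=1,\dots,N$ with storage efficiency $\alpha$ and transfer efficiency $\beta$, $0\le\alpha\le1$, $0\le\beta\le1$, and storage capacity $S_{\max}\ge0$. Let $E(t)=(E_1(t),E_2(t))$, $1\le t\le N$, be real random variables (the net energies) with an arbitrary joint distribution. A policy chooses in each slot $t$, as a measurable function of $E(1),\dots,E(t)$, numbers $w_i,c_i,d_i,x_{12},x_{21}\ge0$ ($i=1,2$). With the storage dynamics $s_i(t+1)=s_i(t)+\alpha c_i(t)-d_i(t)$, it is admissible from slot $k$ and storage levels $s(k)\in[0,S_{\max}]^2$ if almost surely, for $k\le t\le N$ and $i=1,2$, $$d_i(t)\le s_i(t),\qquad 0\le s_i(t+1)\le S_{\max},$$ $$E_1(t)+w_1(t)-c_1(t)+\alpha d_1(t)-x_{12}(t)+\beta x_{21}(t)\ge0,\qquad E_2(t)+w_2(t)-c_2(t)+\alpha d_2(t)-x_{21}(t)+\beta x_{12}(t)\ge0.$$ A greedy policy is a policy that in each slot $t$, given $s(t)$ and $E(t)$, almost surely first minimizes $w_1(t)+w_2(t)$ over all choices satisfying these constraints of slot $t$ and, among the minimizers, maximizes $s_1(t+1)+s_2(t+1)$.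 Suppose that $\beta>\alpha$ and that $E_1(t)\ge0$ almost surely for all $1\le t\le N$. Then for every $1\le k\le N$ and every $s(k)\in[0,S_{\max}]^2$ a greedy policy exists, and it can be chosen such that almost surely $c_i(t)d_i(t)=0$ and $x_{12}(t)x_{21}(t)=0$ for all $k\le t\le N$ and $i=1,2$. Moreover, every greedy policy is optimal: it is admissible and minimizes the expected cost-to-go $$\mathbb E\Big(\sum_{t=k}^{N}(w_1(t)+w_2(t))\Big)\in[0,\infty]$$ over all admissible policies. The same holds if, instead, $E_2(t)\ge0$ almost surely for all $1\le t\le N$ (and $\beta>\alpha$). -/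

import Mathlib

open MeasureTheory

namespace EnergyCoop

/-- The control variables of one time slot. Base stations are indexed by `Fin 2`:
index `0` is BS 1 and index `1` is BS 2. -/
structure Action where
  /-- energy drawn from the conventional source (main grid) at each BS -/
  w : Fin 2 → ℝ
  /-- energy sent to the storage of each BS -/
  c : Fin 2 → ℝ
  /-- energy discharged from the storage of each BS -/
  d : Fin 2 → ℝ
  /-- energy sent by each BS to the other one: `x 0` is `x₁₂` and `x 1` is `x₂₁` -/
  x : Fin 2 → ℝ

/-- Total conventional energy drawn in one slot, `w₁ + w₂`. -/
def Action.grid (a : Action) : ℝ := a.w 0 + a.w 1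

/-- There is no simultaneous charging and discharging at a BS, and no simultaneous transfer in
both directions. -/
def Action.Exclusive (a : Action) : Prop :=
  (∀ i, a.c i * a.d i = 0) ∧ a.x 0 * a.x 1 = 0

/-- Storage dynamics `s(t+1) = s(t) + α c(t) - d(t)`. -/
def nextStorage (α : ℝ) (s : Fin 2 → ℝ) (a : Action) : Fin 2 → ℝ :=
  fun i => s i + α * a.c i - a.d i

/-- The one-slot constraints, for storage levels `s` and net energies `e`:
nonnegativity, discharging at most what is stored, storage levels staying in `[0, Smax]`, and
energy neutralization `eᵢ + wᵢ - cᵢ + α dᵢ - xᵢⱼ + β xⱼᵢ ≥ 0` (`i.rev` is the other BS). -/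
structure Feasible (α β Smax : ℝ) (s e : Fin 2 → ℝ) (a : Action) : Prop where
  w_nonneg : ∀ i, 0 ≤ a.w i
  c_nonneg : ∀ i, 0 ≤ a.c i
  d_nonneg : ∀ i, 0 ≤ a.d i
  x_nonneg : ∀ i, 0 ≤ a.x i
  d_le : ∀ i, a.d i ≤ s i
  storage_nonneg : ∀ i, 0 ≤ nextStorage α s a i
  storage_le : ∀ i, nextStorage α s a i ≤ Smax
  neutral : ∀ i, 0 ≤ e i + a.w i - a.c i + α * a.d i - a.x i + β * a.x i.rev

/-- `a` is a solution of the two-step greedy program of one slot: it minimizes the total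
conventional energy among the feasible actions and, among the feasible actions that draw no more
conventional energy, it maximizes the sum of the resulting storage levels. -/
def IsGreedyAction (α β Smax : ℝ) (s e : Fin 2 → ℝ) (a : Action) : Prop :=
  Feasible α β Smax s e a ∧
  (∀ b, Feasible α β Smax s e b → a.grid ≤ b.grid) ∧
  (∀ b, Feasible α β Smax s e b → b.grid ≤ a.grid →
    nextStorage α s b 0 + nextStorage α s b 1 ≤ nextStorage α s a 0 + nextStorage α s a 1)

/-- A control policy: the action of slot `t` is a function of the history
`(E(1), …, E(t))` of net energies, listed by `Fin t`. -/
def Policy : Type := (t : ℕ) → (Fin t → Fin 2 → ℝ) → Action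

/-- All control variables are measurable functions of the history. -/
def Policy.Measurable (p : Policy) : Prop :=
  ∀ t, _root_.Measurable (fun h => (p t h).w) ∧ _root_.Measurable (fun h => (p t h).c) ∧
    _root_.Measurable (fun h => (p t h).d) ∧ _root_.Measurable (fun h => (p t h).x)

section Model

variable {Ω : Type*}

/-- The history `(E(1), …, E(t))`. -/
def history (E : ℕ → Ω → Fin 2 → ℝ) (t : ℕ) (ω : Ω) : Fin t → Fin 2 → ℝ :=
  fun j => E ((j : ℕ) + 1) ω

/-- The action that the policy takes in slot `t`. -/
def Policy.act (p : Policy) (E : ℕ → Ω → Fin 2 → ℝ) (t : ℕ) (ω : Ω) : Action :=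
  p t (history E t ω)

/-- The storage levels `s(t)`, `t ≥ k`, under policy `p` when `s(k) = s`
(the value is `s` for `t < k`, which is never used). -/
def storage (α : ℝ) (p : Policy) (E : ℕ → Ω → Fin 2 → ℝ) (k : ℕ) (s : Fin 2 → ℝ) (ω : Ω) :
    ℕ → Fin 2 → ℝ
  | 0 => s
  | t + 1 => if k ≤ t then nextStorage α (storage α p E k s ω t) (p.act E t ω) else s

variable [MeasurableSpace Ω]

/-- `p` is a (measurable, history-dependent) policy that, started in slot `k` with storage
levels `s`, almost surely satisfies all constraints in the slots `k, …, N`. -/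
def Admissible (α β Smax : ℝ) (N : ℕ) (μ : Measure Ω) (E : ℕ → Ω → Fin 2 → ℝ)
    (k : ℕ) (s : Fin 2 → ℝ) (p : Policy) : Prop :=
  p.Measurable ∧ ∀ t ∈ Finset.Icc k N, ∀ᵐ ω ∂μ,
    Feasible α β Smax (storage α p E k s ω t) (E t ω) (p.act E t ω)

/-- `p` is a greedy policy in the slots `k, …, N`, started in slot `k` with storage levels `s`:
almost surely each of its actions solves the greedy program for the current storage levels and
the current net energies. -/
def IsGreedy (α β Smax : ℝ) (N : ℕ) (μ : Measure Ω) (E : ℕ → Ω → Fin 2 → ℝ)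
    (k : ℕ) (s : Fin 2 → ℝ) (p : Policy) : Prop :=
  p.Measurable ∧ ∀ t ∈ Finset.Icc k N, ∀ᵐ ω ∂μ,
    IsGreedyAction α β Smax (storage α p E k s ω t) (E t ω) (p.act E t ω)

/-- The expected cost-to-go `𝔼 ∑_{t = k}^N (w₁(t) + w₂(t))`, as an element of `[0, ∞]`
(the summands are almost surely nonnegative for admissible policies). -/
noncomputable def costToGo (N : ℕ) (μ : Measure Ω) (E : ℕ → Ω → Fin 2 → ℝ)
    (k : ℕ) (p : Policy) : ENNReal :=
  ∫⁻ ω, ENNReal.ofReal (∑ t ∈ Finset.Icc k N, (p.act E t ω).grid) ∂μ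

/-- `p` is admissible and minimizes the expected cost-to-go from slot `k` and storage levels `s`
among all admissible policies. -/
def IsOptimal (α β Smax : ℝ) (N : ℕ) (μ : Measure Ω) (E : ℕ → Ω → Fin 2 → ℝ)
    (k : ℕ) (s : Fin 2 → ℝ) (p : Policy) : Prop :=
  Admissible α β Smax N μ E k s p ∧
  ∀ q, Admissible α β Smax N μ E k s q → costToGo N μ E k p ≤ costToGo N μ E k q

end Model

end EnergyCoop

namespace EnergyCoop

/-! Let station `i` never be in deficit, and let j be `i.rev`. Only j can need help: there a unit
stored at j is worth α and a unit stored at `i` is worth αβ. So α(β s_i + s_j) measures what the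
storages can save, and a greedy trajectory should never trail a competitor in it by more than its
accumulated cost advantage D. This alone is not inductive: when j is full its surplus flows to `i`,
and the exchange rate is reversed. Hence the second inequality of `Dominates`, with weights 1 and β.

`Dominates.canon_step` shows that the pair is preserved by an explicit action. Weighted energy
balances bound every competitor; where a balance does not suffice, a full or empty store supplies
the missing inequality. If grid energy is drawn, the stores are empty, which forces D ≥ 0. The
hypothesis α < β makes sending surplus to a deficit no worse than storing it.

Weighting the two inequalities by β and 1 gives a multiple of total storage. So the explicit action
is greedy, and every greedy action attains the same two weighted values (`Dominates.greedy_step`).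
The comparison of costs thus holds on almost every sample path, and then in expectation. -/

theorem forall_fin_two_iff (i : Fin 2) {P : Fin 2 → Prop} : (∀ m, P m) ↔ P i ∧ P i.rev := by
  fin_cases i
  · exact Fin.forall_fin_two
  · exact Fin.forall_fin_two.trans and_comm

theorem add_eq_add_rev (i : Fin 2) (f : Fin 2 → ℝ) : f 0 + f 1 = f i + f i.rev := by
  fin_cases i
  · rfl
  · exact add_comm _ _

theorem mul_eq_mul_rev (i : Fin 2) (f : Fin 2 → ℝ) : f 0 * f 1 = f i * f i.rev := by
  fin_cases i
  · rfl
  · exact mul_comm _ _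

/-- The vector with entry `p` at station `i` and `q` at the other station. -/
def pair (i : Fin 2) (p q : ℝ) : Fin 2 → ℝ := fun m => if m = i then p else q

@[simp] theorem pair_self (i : Fin 2) (p q : ℝ) : pair i p q i = p := by simp [pair]

@[simp] theorem pair_rev (i : Fin 2) (p q : ℝ) : pair i p q i.rev = q := by
  fin_cases i <;> simp [pair]

theorem measurable_pair {X : Type*} [MeasurableSpace X] (i : Fin 2) {f g : X → ℝ}
    (hf : Measurable f) (hg : Measurable g) : Measurable fun x => pair i (f x) (g x) := by
  refine measurable_pi_lambda _ fun m => ?_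
  unfold pair
  split_ifs
  exacts [hf, hg]

/-- Storage levels `a` with a cost advantage `D` are at least as good as storage levels `b`, when
station `i` is never in deficit. -/
structure Dominates (α β : ℝ) (i : Fin 2) (D : ℝ) (a b : Fin 2 → ℝ) : Prop where
  nonneg : 0 ≤ D
  left : α * (β * b i + b i.rev) ≤ α * (β * a i + a i.rev) + D
  right : α * β * (b i + β * b i.rev) ≤ α * β * (a i + β * a i.rev) + D

/-! ### Weighted energy balances of one slot -/

section Bounds

variable {α β S : ℝ} {s e : Fin 2 → ℝ} {b : Action}

/-- Weighted energy balance with weights `β` and `1`. -/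
theorem Feasible.balance_left (hα : 0 ≤ α) (hα1 : α ≤ 1) (hβ0 : 0 ≤ β) (hβ : β ≤ 1) (i : Fin 2)
    (h : Feasible α β S s e b) :
    α * (β * nextStorage α s b i + nextStorage α s b i.rev) ≤
      α * (β * s i + s i.rev) + (β * e i + e i.rev) + b.grid ∧
    α * (β * nextStorage α s b i + nextStorage α s b i.rev) ≤
      α * (β * s i + s i.rev) + α ^ 2 * (β * e i + e i.rev) + b.grid := by
  have n1 := h.neutral i
  have n2 := h.neutral i.rev
  rw [Fin.rev_rev] at n2
  have hg : b.grid = b.w i + b.w i.rev := add_eq_add_rev i b.w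
  have w1 := h.w_nonneg i
  have w2 := h.w_nonneg i.rev
  have c1 := h.c_nonneg i
  have c2 := h.c_nonneg i.rev
  have d1 := h.d_nonneg i
  have d2 := h.d_nonneg i.rev
  have y := h.x_nonneg i.rev
  simp only [nextStorage, hg]
  generalize b.w i = W1 at *
  generalize b.w i.rev = W2 at *
  generalize b.c i = C1 at *
  generalize b.c i.rev = C2 at *
  generalize b.d i = D1 at *
  generalize b.d i.rev = D2 at *
  generalize b.x i.rev = Y at *
  generalize b.x i = X at *
  have hα2 : α ^ 2 ≤ 1 := pow_le_one₀ hα hα1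
  have hβ2 : 0 ≤ 1 - β ^ 2 := by nlinarith
  -- With weights β and 1 the transfer out of `i` cancels, and the reverse transfer only loses
  -- energy.
  have key : (β * C1 + C2) - α * (β * D1 + D2) ≤ β * e i + e i.rev + (W1 + W2) := by
    nlinarith [mul_le_mul_of_nonneg_left n1 hβ0, mul_nonneg hβ2 y,
      mul_nonneg (sub_nonneg.2 hβ) w1]
  have hC : 0 ≤ β * C1 + C2 := by positivity
  have hD : 0 ≤ α * (β * D1 + D2) := by positivity
  constructor
  · nlinarith [mul_nonneg (sub_nonneg.2 hα2) hC]
  · nlinarith [mul_nonneg (sub_nonneg.2 hα2) hD, mul_le_mul_of_nonneg_left key (sq_nonneg α),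
      mul_nonneg (sub_nonneg.2 hα2) (add_nonneg w1 w2)]

/-- Weighted energy balance with weights `1` and `β`. -/
theorem Feasible.balance_right (hα : 0 ≤ α) (hαβ : α ≤ β) (hβ : β ≤ 1) (i : Fin 2)
    (h : Feasible α β S s e b) :
    α * β * (nextStorage α s b i + β * nextStorage α s b i.rev) ≤
      α * β * (s i + β * s i.rev) + α ^ 2 * β * (e i + β * e i.rev) + b.grid := by
  have hβ0 : 0 ≤ β := hα.trans hαβ
  have n1 := h.neutral i
  have n2 := h.neutral i.rev
  rw [Fin.rev_rev] at n2
  have hg : b.grid = b.w i + b.w i.rev := add_eq_add_rev i b.w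
  have w1 := h.w_nonneg i
  have w2 := h.w_nonneg i.rev
  have d1 := h.d_nonneg i
  have d2 := h.d_nonneg i.rev
  have y := h.x_nonneg i
  simp only [nextStorage, hg]
  generalize b.w i = W1 at *
  generalize b.w i.rev = W2 at *
  generalize b.c i = C1 at *
  generalize b.c i.rev = C2 at *
  generalize b.d i = D1 at *
  generalize b.d i.rev = D2 at *
  generalize b.x i.rev = Y at *
  generalize b.x i = X at *
  have hα2 : α ^ 2 ≤ 1 := pow_le_one₀ hα (hαβ.trans hβ)
  have hβ2 : 0 ≤ 1 - β ^ 2 := by nlinarith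
  have key : (C1 + β * C2) - α * (D1 + β * D2) ≤ e i + β * e i.rev + (W1 + W2) := by
    nlinarith [mul_le_mul_of_nonneg_left n2 hβ0, mul_nonneg hβ2 y,
      mul_nonneg (sub_nonneg.2 hβ) w2]
  have hD : 0 ≤ α * β * (D1 + β * D2) := by positivity
  have hk : α ^ 2 * β ≤ 1 := mul_le_one₀ hα2 hβ0 hβ
  nlinarith [mul_nonneg (sub_nonneg.2 hα2) hD,
    mul_le_mul_of_nonneg_left key (mul_nonneg (sq_nonneg α) hβ0),
    mul_nonneg (sub_nonneg.2 hk) (add_nonneg w1 w2)]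

/-- Energy balance with weights `β` and `1`, as a bound on the stored energy with weights
`1` and `β`. -/
theorem Feasible.balance_right' (hα : 0 ≤ α) (hαβ : α ≤ β) (hβ : β ≤ 1) (i : Fin 2)
    (h : Feasible α β S s e b) :
    α * β * (nextStorage α s b i + β * nextStorage α s b i.rev) ≤
      α * β * (s i + β * s i.rev) + α ^ 2 * (β * e i + e i.rev) + b.grid ∧
    α * β * (nextStorage α s b i + β * nextStorage α s b i.rev) ≤
      α * β * (s i + β * s i.rev) + β ^ 2 * (β * e i + e i.rev) + b.grid := by
  have hβ0 : 0 ≤ β := hα.trans hαβ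
  have n1 := h.neutral i
  have n2 := h.neutral i.rev
  rw [Fin.rev_rev] at n2
  have hg : b.grid = b.w i + b.w i.rev := add_eq_add_rev i b.w
  have w1 := h.w_nonneg i
  have w2 := h.w_nonneg i.rev
  have c1 := h.c_nonneg i
  have c2 := h.c_nonneg i.rev
  have d1 := h.d_nonneg i
  have d2 := h.d_nonneg i.rev
  have y := h.x_nonneg i.rev
  simp only [nextStorage, hg]
  generalize b.w i = W1 at *
  generalize b.w i.rev = W2 at *
  generalize b.c i = C1 at *
  generalize b.c i.rev = C2 at *
  generalize b.d i = D1 at *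
  generalize b.d i.rev = D2 at *
  generalize b.x i.rev = Y at *
  generalize b.x i = X at *
  have hα2 : α ^ 2 ≤ 1 := pow_le_one₀ hα (hαβ.trans hβ)
  have hβ2 : β ^ 2 ≤ 1 := pow_le_one₀ hβ0 hβ
  have hαβ2 : α ^ 2 ≤ β ^ 2 := pow_le_pow_left₀ hα hαβ 2
  have key : (β * C1 + C2) - α * (β * D1 + D2) ≤ β * e i + e i.rev + (W1 + W2) := by
    nlinarith [mul_le_mul_of_nonneg_left n1 hβ0, mul_nonneg (sub_nonneg.2 hβ2) y,
      mul_nonneg (sub_nonneg.2 hβ) w1]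
  have hαD1 : 0 ≤ α * β * D1 := by positivity
  have hαD2 : 0 ≤ α * D2 := by positivity
  have hβC1 : 0 ≤ β * C1 := by positivity
  have t1 := mul_nonneg (sub_nonneg.2 hα2) (add_nonneg w1 w2)
  have t2 := mul_nonneg (sub_nonneg.2 hβ2) (add_nonneg w1 w2)
  have t3 := mul_nonneg (sub_nonneg.2 hα2) hαD1
  have t4 := mul_nonneg (sub_nonneg.2 hβ2) hαD1
  have t5 := mul_nonneg (sub_nonneg.2 hαβ2) hαD2
  -- Here α ≤ β is essential: storing a unit at `i` instead of sending it gains α²β, but replacing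
  -- it from the store of the other station costs β³.
  have t6 := mul_nonneg (sub_nonneg.2 hαβ2) hβC1
  have t7 := mul_nonneg (mul_nonneg (sub_nonneg.2 hβ2) (sq_nonneg α)) c2
  have t8 := mul_nonneg (mul_nonneg (sub_nonneg.2 hα2) (sq_nonneg β)) c2
  have k1 := mul_le_mul_of_nonneg_left key (sq_nonneg α)
  have k2 := mul_le_mul_of_nonneg_left key (sq_nonneg β)
  constructor <;> linarith

end Bounds

/-! ### The explicit greedy action -/

/-- Charge the local storage with surplus `u` and room `r`, after which the other station, with
surplus `v` and room `q`, sends what it cannot store itself: the additional charge. -/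
noncomputable def spill (β u r v q : ℝ) : ℝ := min (β * (v - min v q)) (r - min u r)

open Classical in
/-- An explicit solution of the greedy program when station `i` is not in deficit. -/
noncomputable def canon (α β S : ℝ) (i : Fin 2) (s e : Fin 2 → ℝ) : Action :=
  let m := min (e i.rev) 0
  let u := e i + m / β
  let v := max (e i.rev) 0
  let r := (S - s i) / α
  let q := (S - s i.rev) / α
  let f := β * e i + m
  -- The deficit `-f` is met first from the local store, at rate α, then from station `i`, at rate
  -- αβ. For α = 0 the quotients are 0, so nothing is charged or discharged.
  let dj := min (s i.rev) (-f / α)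
  let di := min (s i) ((-f - α * dj) / (α * β))
  if 0 ≤ f then
    { w := 0
      c := pair i (min u r + spill β u r v q) (min v q + spill β v q u r)
      d := 0
      x := pair i (-m / β + spill β v q u r / β) (spill β u r v q / β) }
  else
    { w := pair i 0 (-f - α * dj - α * β * di)
      c := 0
      d := pair i di dj
      x := pair i (e i + α * di) 0 }

theorem measurable_canon {X : Type*} [MeasurableSpace X] (α β S : ℝ) (i : Fin 2)
    {s e : X → Fin 2 → ℝ} (hs : Measurable s) (he : Measurable e) :
    Measurable (fun x => (canon α β S i (s x) (e x)).w) ∧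
    Measurable (fun x => (canon α β S i (s x) (e x)).c) ∧
    Measurable (fun x => (canon α β S i (s x) (e x)).d) ∧
    Measurable (fun x => (canon α β S i (s x) (e x)).x) := by
  have hs' : ∀ m, Measurable fun x => s x m := fun m => (measurable_pi_apply m).comp hs
  have he' : ∀ m, Measurable fun x => e x m := fun m => (measurable_pi_apply m).comp he
  have h1 := hs' i
  have h2 := hs' i.rev
  have h3 := he' i
  have h4 := he' i.rev
  have hset : MeasurableSet {x | 0 ≤ β * e x i + min (e x i.rev) 0} :=
    measurableSet_le measurable_const (by fun_prop)
  simp only [canon, apply_ite Action.w, apply_ite Action.c, apply_ite Action.d,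
    apply_ite Action.x, spill]
  refine ⟨?_, ?_, ?_, ?_⟩ <;> refine Measurable.ite hset ?_ ?_ <;>
    first
    | exact measurable_const
    | (refine measurable_pair i ?_ ?_ <;> fun_prop)

section Spill

variable {β u r v q : ℝ}

theorem spill_nonneg (hβ : 0 ≤ β) : 0 ≤ spill β u r v q :=
  le_min (mul_nonneg hβ (sub_nonneg.2 (min_le_left _ _))) (sub_nonneg.2 (min_le_right _ _))

theorem min_add_spill_le : min u r + spill β u r v q ≤ r := by
  have : spill β u r v q ≤ r - min u r := min_le_right _ _
  linarith

theorem spill_div_le (hβ : 0 < β) : spill β u r v q / β ≤ v - min v q := by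
  rw [div_le_iff₀ hβ, mul_comm]
  exact min_le_left _ _

theorem spill_eq_zero_of_le (h : v ≤ q) : spill β u r v q = 0 := by
  have : 0 ≤ r - min u r := sub_nonneg.2 (min_le_right _ _)
  simp [spill, min_eq_left h, this]

theorem spill_eq_zero_of_ge (hβ : 0 ≤ β) (h : r ≤ u) : spill β u r v q = 0 := by
  have : 0 ≤ β * (v - min v q) := mul_nonneg hβ (sub_nonneg.2 (min_le_left _ _))
  simp [spill, min_eq_right h, this]

/-- A station spills only when its own store is full, and then it has no room to receive. -/
theorem spill_mul_spill (hβ : 0 ≤ β) : spill β u r v q * spill β v q u r = 0 := by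
  rcases le_total u r with h | h
  · rw [spill_eq_zero_of_le (u := v) h, mul_zero]
  · rw [spill_eq_zero_of_ge hβ h, zero_mul]

/-- Each store is either full or pinned down by an energy balance without loss; the weights of that
balance depend on the direction of the spill. -/
theorem charge_cases (hβ : 0 ≤ β) :
    (min u r + spill β u r v q = r ∧ min v q + spill β v q u r = q) ∨
    (min u r + spill β u r v q = r ∧
      β * (min u r + spill β u r v q) + (min v q + spill β v q u r) = β * u + v) ∨
    (min v q + spill β v q u r = q ∧
      (min u r + spill β u r v q) + β * (min v q + spill β v q u r) = u + β * v) ∨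
    (min u r + spill β u r v q = u ∧ min v q + spill β v q u r = v) := by
  rcases le_total u r with h1 | h1 <;> rcases le_total v q with h2 | h2
  · right; right; right
    rw [spill_eq_zero_of_le h1, spill_eq_zero_of_le h2]
    simp [h1, h2]
  · rw [spill_eq_zero_of_le (u := v) h1]
    simp only [spill, min_eq_left h1, min_eq_right h2]
    rcases le_total (β * (v - q)) (r - u) with h | h
    · right; right; left
      rw [min_eq_left h]
      constructor <;> ring
    · left
      rw [min_eq_right h]
      constructor <;> ring
  · rw [spill_eq_zero_of_le (u := u) h2]
    simp only [spill, min_eq_left h2, min_eq_right h1]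
    rcases le_total (β * (u - r)) (q - v) with h | h
    · right; left
      rw [min_eq_left h]
      constructor <;> ring
    · left
      rw [min_eq_right h]
      constructor <;> ring
  · left
    rw [spill_eq_zero_of_ge hβ h1, spill_eq_zero_of_ge hβ h2]
    simp [h1, h2]

end Spill

theorem mul_div_le_of_nonneg {α t : ℝ} (ht : 0 ≤ t) : α * (t / α) ≤ t := by
  rcases eq_or_ne α 0 with rfl | h
  · simpa
  · exact (mul_div_cancel₀ t h).le

/-! ### Feasibility and dominance of the explicit action -/

section Canon

variable {α β S : ℝ} {i : Fin 2} {s e : Fin 2 → ℝ}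

theorem canon_feasible (hα : 0 ≤ α) (hαβ : α < β) (hβ : β ≤ 1)
    (hs : ∀ m, 0 ≤ s m ∧ s m ≤ S) (he : 0 ≤ e i) :
    Feasible α β S s e (canon α β S i s e) := by
  have hβ0 : 0 < β := hα.trans_lt hαβ
  have hα1 : α ≤ 1 := hαβ.le.trans hβ
  obtain ⟨h10, h1S⟩ := hs i
  obtain ⟨h20, h2S⟩ := hs i.rev
  have hm : min (e i.rev) 0 ≤ 0 := min_le_right _ _
  have hm' : min (e i.rev) 0 + max (e i.rev) 0 = e i.rev := by
    rw [min_add_max, add_zero]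
  have hv : 0 ≤ max (e i.rev) 0 := le_max_right _ _
  have hmv : min (e i.rev) 0 = 0 ∨ max (e i.rev) 0 = 0 :=
    (le_total 0 (e i.rev)).imp min_eq_right max_eq_right
  simp only [canon]
  generalize max (e i.rev) 0 = v at *
  generalize min (e i.rev) 0 = m at *
  split_ifs with hf
  · set u := e i + m / β with hu
    have hu0 : 0 ≤ u := by
      have : β * u = β * e i + m := by rw [hu]; field_simp
      exact nonneg_of_mul_nonneg_right (by linarith) hβ0
    set r := (S - s i) / α with hr
    set q := (S - s i.rev) / α with hq
    have hr0 : 0 ≤ r := div_nonneg (by linarith) hα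
    have hq0 : 0 ≤ q := div_nonneg (by linarith) hα
    have hr1 : α * r ≤ S - s i := mul_div_le_of_nonneg (by linarith)
    have hq1 : α * q ≤ S - s i.rev := mul_div_le_of_nonneg (by linarith)
    have p0 : 0 ≤ spill β u r v q := spill_nonneg hβ0.le
    have q0 : 0 ≤ spill β v q u r := spill_nonneg hβ0.le
    have p1 : min u r + spill β u r v q ≤ r := min_add_spill_le
    have q1 : min v q + spill β v q u r ≤ q := min_add_spill_le
    have p2 : spill β u r v q / β ≤ v - min v q := spill_div_le hβ0
    have q2 : spill β v q u r / β ≤ u - min u r := spill_div_le hβ0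
    have u0 : 0 ≤ min u r := le_min hu0 hr0
    have v0 : 0 ≤ min v q := le_min hv hq0
    have p3 : β * (spill β u r v q / β) = spill β u r v q := mul_div_cancel₀ _ hβ0.ne'
    have q3 : β * (spill β v q u r / β) = spill β v q u r := mul_div_cancel₀ _ hβ0.ne'
    have m3 : β * (m / β) = m := mul_div_cancel₀ _ hβ0.ne'
    have m4 : 0 ≤ -m / β := div_nonneg (by linarith) hβ0.le
    have p4 : 0 ≤ spill β u r v q / β := div_nonneg p0 hβ0.le
    have q4 : 0 ≤ spill β v q u r / β := div_nonneg q0 hβ0.le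
    rw [neg_div] at *
    generalize spill β u r v q = P at *
    generalize spill β v q u r = Q at *
    constructor <;> rw [forall_fin_two_iff i] <;>
      simp only [nextStorage, pair_self, pair_rev, Pi.zero_apply, Fin.rev_rev] <;>
      constructor <;> first | positivity | nlinarith
  · set f := β * e i + m with hfdef
    have hf' : 0 ≤ -f := by linarith
    have hv0 : v = 0 := by
      rcases hmv with h | h
      · rw [h, add_zero] at hfdef
        exact absurd (hfdef ▸ mul_nonneg hβ0.le he) hf
      · exact h
    set dj := min (s i.rev) (-f / α) with hdj
    have hdj0 : 0 ≤ dj := le_min h20 (div_nonneg hf' hα)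
    have hdj1 : α * dj ≤ -f :=
      (mul_le_mul_of_nonneg_left (min_le_right _ _) hα).trans (mul_div_le_of_nonneg hf')
    have hdj2 : dj ≤ s i.rev := min_le_left _ _
    have hf'' : 0 ≤ -f - α * dj := by linarith
    set di := min (s i) ((-f - α * dj) / (α * β)) with hdi
    have hdi0 : 0 ≤ di := le_min h10 (div_nonneg hf'' (mul_nonneg hα hβ0.le))
    have hdi1 : α * β * di ≤ -f - α * dj :=
      (mul_le_mul_of_nonneg_left (min_le_right _ _) (mul_nonneg hα hβ0.le)).trans
        (mul_div_le_of_nonneg hf'')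
    have hdi2 : di ≤ s i := min_le_left _ _
    clear_value di dj
    constructor <;> rw [forall_fin_two_iff i] <;>
      simp only [nextStorage, pair_self, pair_rev, Pi.zero_apply, Fin.rev_rev] <;>
      constructor <;> first | positivity | linarith

theorem canon_exclusive (hα : 0 ≤ α) (hαβ : α < β) (hs : s i.rev ≤ S) :
    (canon α β S i s e).Exclusive := by
  have hβ0 : 0 < β := hα.trans_lt hαβ
  simp only [Action.Exclusive, mul_eq_mul_rev i, canon]
  split_ifs with hf
  · refine ⟨by simp, ?_⟩
    simp only [pair_self, pair_rev]
    have hq : 0 ≤ (S - s i.rev) / α := div_nonneg (by linarith) hα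
    -- A station in deficit has no surplus to spill, so covering its deficit never meets a transfer
    -- in the opposite direction.
    have h1 : min (e i.rev) 0 * spill β (e i + min (e i.rev) 0 / β) ((S - s i) / α)
        (max (e i.rev) 0) ((S - s i.rev) / α) = 0 := by
      rcases le_total (e i.rev) 0 with h | h
      · rw [max_eq_right h, spill_eq_zero_of_le hq, mul_zero]
      · rw [min_eq_right h, zero_mul]
    have h2 := spill_mul_spill (u := e i + min (e i.rev) 0 / β) (r := (S - s i) / α)
      (v := max (e i.rev) 0) (q := (S - s i.rev) / α) hβ0.le
    rw [← add_div, div_mul_div_comm, add_mul, neg_mul, h1, mul_comm (spill _ _ _ _ _), h2]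
    simp
  · exact ⟨by simp, by simp⟩

theorem canon_grid_of_nonneg (hf : 0 ≤ β * e i + min (e i.rev) 0) :
    (canon α β S i s e).grid = 0 := by
  simp [canon, hf, Action.grid]

/-- The explicit action preserves dominance over every feasible action. -/
theorem Dominates.canon_step (hα : 0 ≤ α) (hαβ : α < β) (hβ : β ≤ 1)
    {a b : Fin 2 → ℝ} {D : ℝ} {g : Action} (ha : ∀ m, 0 ≤ a m ∧ a m ≤ S) (he : 0 ≤ e i)
    (hab : Dominates α β i D a b) (hg : Feasible α β S b e g) :
    Dominates α β i (D + g.grid - (canon α β S i a e).grid)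
      (nextStorage α a (canon α β S i a e)) (nextStorage α b g) := by
  have hβ0 : 0 < β := hα.trans_lt hαβ
  have hα1 : α ≤ 1 := hαβ.le.trans hβ
  have hβ2 : β ^ 2 ≤ 1 := pow_le_one₀ hβ0.le hβ
  obtain ⟨hD, hL, hR⟩ := hab
  obtain ⟨h10, h1S⟩ := ha i
  obtain ⟨h20, h2S⟩ := ha i.rev
  have hw : 0 ≤ g.grid := add_nonneg (hg.w_nonneg 0) (hg.w_nonneg 1)
  obtain ⟨bl1, bl2⟩ := hg.balance_left hα hα1 hβ0.le hβ i
  have br := hg.balance_right hα hαβ.le hβ i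
  obtain ⟨br1, br2⟩ := hg.balance_right' hα hαβ.le hβ i
  have b10 := hg.storage_nonneg i
  have b20 := hg.storage_nonneg i.rev
  have b1S := hg.storage_le i
  have b2S := hg.storage_le i.rev
  generalize nextStorage α b g = b' at *
  generalize g.grid = w at *
  by_cases hf : 0 ≤ β * e i + min (e i.rev) 0
  · rw [canon_grid_of_nonneg hf, sub_zero]
    have hβu : β * (e i + min (e i.rev) 0 / β) = β * e i + min (e i.rev) 0 := by
      field_simp
    have hF : β * (e i + min (e i.rev) 0 / β) + max (e i.rev) 0 = β * e i + e i.rev := by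
      rw [hβu, add_assoc, min_add_max, add_zero]
    have hG : α * β * (b' i + β * b' i.rev) ≤ α * β * (b i + β * b i.rev) +
        α ^ 2 * β * ((e i + min (e i.rev) 0 / β) + β * max (e i.rev) 0) + w := by
      rcases le_total (e i.rev) 0 with h | h
      · rw [max_eq_right h, add_zero] at hF
        rw [max_eq_right h, mul_zero, add_zero, mul_assoc (α ^ 2), hF]
        exact br1
      · rw [max_eq_left h, min_eq_right h, zero_div, add_zero]
        exact br
    rw [← hF] at bl2
    rcases eq_or_ne α 0 with rfl | h0
    · exact ⟨by linarith, by linarith, by linarith⟩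
    have hr : α * ((S - a i) / α) = S - a i := mul_div_cancel₀ _ h0
    have hq : α * ((S - a i.rev) / α) = S - a i.rev := mul_div_cancel₀ _ h0
    have hc := charge_cases (u := e i + min (e i.rev) 0 / β) (r := (S - a i) / α)
      (v := max (e i.rev) 0) (q := (S - a i.rev) / α) hβ0.le
    have hαβ0 : 0 ≤ α * β := mul_nonneg hα hβ0.le
    have hβ' : 0 ≤ 1 - β ^ 2 := sub_nonneg.2 hβ2
    refine ⟨by linarith, ?_, ?_⟩ <;>
      simp only [canon, if_pos hf, nextStorage, pair_self, pair_rev, Pi.zero_apply, sub_zero]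
    all_goals
      generalize e i + min (e i.rev) 0 / β = u at *
      generalize max (e i.rev) 0 = v at *
      generalize (S - a i) / α = r at *
      generalize (S - a i.rev) / α = q at *
      generalize min u r + spill β u r v q = p1 at *
      generalize min v q + spill β v q u r = p2 at *
      have s1 := mul_nonneg hα (sub_nonneg.2 b1S)
      have s2 := mul_nonneg hα (sub_nonneg.2 b2S)
      rcases hc with ⟨h1, h2⟩ | ⟨h1, h2⟩ | ⟨h1, h2⟩ | ⟨h1, h2⟩
    · rw [h1, h2, hr, hq]
      linarith [mul_nonneg hβ0.le s1]
    · have := congrArg (α ^ 2 * ·) h2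
      linarith
    · have := congrArg (α ^ 2 * β * ·) h2
      have h3 : α * p2 = S - a i.rev := by rw [h1, hq]
      have := congrArg (β ^ 2 * α * ·) h3
      have := congrArg (α * ·) h3
      -- Station `i.rev` is full, so the `left` inequality follows from the `right` one by raising
      -- the weight of that store.
      linarith [mul_nonneg hβ' s2]
    · rw [h1, h2]
      linarith
    · rw [h1, h2, hr, hq]
      linarith [mul_nonneg hβ0.le s1, mul_nonneg (mul_nonneg hβ0.le hβ0.le) s2]
    · have := congrArg (α ^ 2 * β ^ 2 * ·) h2
      have h3 : α * p1 = S - a i := by rw [h1, hr]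
      have := congrArg (β ^ 3 * α * ·) h3
      have := congrArg (α * β * ·) h3
      -- Station `i` is full: β² times the `left` inequality, plus extra weight on that store, gives
      -- the `right` one.
      linarith [mul_nonneg (mul_nonneg hβ0.le hβ') s1, mul_nonneg hβ' (add_nonneg hD hw),
        mul_le_mul_of_nonneg_left (bl2.trans (add_le_add_left (add_le_add_left hL _) _))
          (sq_nonneg β)]
    · have := congrArg (α ^ 2 * β * ·) h2
      linarith
    · rw [h1, h2]
      linarith
  · have hneg : e i.rev ≤ 0 := by
      by_contra! h
      rw [min_eq_right h.le, add_zero] at hf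
      exact hf (mul_nonneg hβ0.le he)
    rw [min_eq_left hneg] at hf
    simp only [canon, min_eq_left hneg, if_neg hf, Action.grid,
      add_eq_add_rev i (pair i _ _)]
    set f := β * e i + e i.rev with hfdef
    have hf' : 0 ≤ -f := by linarith
    set dj := min (a i.rev) (-f / α) with hdj
    set di := min (a i) ((-f - α * dj) / (α * β)) with hdi
    have hAi : 0 ≤ a i - di := sub_nonneg.2 (min_le_left _ _)
    have left : α * (β * b' i + b' i.rev) ≤ α * (β * (a i - di) + (a i.rev - dj)) +
        (D + w - (-f - α * dj - α * β * di)) := by linarith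
    have hb : α * β * (b' i + β * b' i.rev) ≤ α * (β * b' i + b' i.rev) := by
      linarith [mul_nonneg (sub_nonneg.2 hβ2) (mul_nonneg hα b20)]
    have hb0 : 0 ≤ α * (β * b' i + b' i.rev) := by positivity
    rcases eq_or_ne α 0 with rfl | h0
    · constructor <;> simp only [nextStorage, pair_self, pair_rev, Pi.zero_apply] <;> linarith
    have h0' : 0 < α := lt_of_le_of_ne hα h0.symm
    have hdi_or : di = a i ∨ α * β * di = -f - α * dj := by
      refine (min_choice _ _).imp id fun h => ?_
      rw [hdi, h]
      exact mul_div_cancel₀ _ (mul_pos h0' hβ0).ne'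
    have hdj_or : dj = a i.rev ∨ α * dj = -f := by
      refine (min_choice _ _).imp id fun h => ?_
      rw [hdj, h]
      exact mul_div_cancel₀ _ h0
    have hdi0 : α * dj = -f → di = 0 := fun h => by
      rw [hdi, h, sub_self, zero_div, min_eq_right h10]
    clear_value di dj
    constructor <;>
      simp only [nextStorage, pair_self, pair_rev, Pi.zero_apply, zero_add, mul_zero, add_zero]
    -- Either both stores are emptied, and `left` bounds the new advantage below by the competitor's
    -- stored value, or no grid energy is drawn.
    · rcases hdj_or with h | h
      · rcases hdi_or with h' | h'
        · rw [← h, ← h'] at left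
          linarith
        · linarith
      · rw [hdi0 h]
        linarith
    · linarith
    · rcases hdj_or with h | h
      · rw [h, sub_self] at left ⊢
        linarith
      · rw [hdi0 h]
        linarith [congrArg (β ^ 2 * ·) h]

end Canon

/-! ### From the explicit action to all greedy actions -/

section Greedy

variable {α β S : ℝ} {i : Fin 2} {s e : Fin 2 → ℝ}

theorem Dominates.refl (α β : ℝ) (i : Fin 2) (a : Fin 2 → ℝ) : Dominates α β i 0 a a :=
  ⟨le_rfl, by simp, by simp⟩

theorem nextStorage_canon_zero (hs : ∀ m, 0 ≤ s m) :
    nextStorage 0 s (canon 0 β S i s e) = s := by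
  have h : ∀ m, nextStorage 0 s (canon 0 β S i s e) m = s m := by
    rw [forall_fin_two_iff i]
    simp only [nextStorage, canon]
    split_ifs <;> simp [hs]
  exact funext h

theorem canon_isGreedyAction (hα : 0 ≤ α) (hαβ : α < β) (hβ : β ≤ 1)
    (hs : ∀ m, 0 ≤ s m ∧ s m ≤ S) (he : 0 ≤ e i) :
    IsGreedyAction α β S s e (canon α β S i s e) := by
  refine ⟨canon_feasible hα hαβ hβ hs he, fun b hb => ?_, fun b hb hle => ?_⟩
  · have := ((Dominates.refl α β i s).canon_step hα hαβ hβ hs he hb).nonneg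
    linarith
  · rcases eq_or_lt_of_le hα with rfl | hα0
    · rw [nextStorage_canon_zero fun m => (hs m).1]
      have h0 := hb.d_nonneg 0
      have h1 := hb.d_nonneg 1
      simp only [nextStorage]
      linarith
    · obtain ⟨-, h1, h2⟩ := (Dominates.refl α β i s).canon_step hα hαβ hβ hs he hb
      have hβ0 : 0 < β := hα.trans_lt hαβ
      rw [add_eq_add_rev i, add_eq_add_rev i]
      -- β times `left` plus `right` has the equal weights αβ(1 + β) on both stores.
      have hpos : 0 < α * β * (1 + β) := by positivity
      refine le_of_mul_le_mul_left ?_ hpos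
      have h3 : α * (β * nextStorage α s b i + nextStorage α s b i.rev) ≤
        α * (β * nextStorage α s (canon α β S i s e) i +
          nextStorage α s (canon α β S i s e) i.rev) := by linarith
      linarith [mul_le_mul_of_nonneg_left h3 hβ0.le]

/-- Every greedy action preserves dominance over every feasible action. -/
theorem Dominates.greedy_step (hα : 0 ≤ α) (hαβ : α < β) (hβ : β ≤ 1)
    {a b : Fin 2 → ℝ} {D : ℝ} {f g : Action} (ha : ∀ m, 0 ≤ a m ∧ a m ≤ S) (he : 0 ≤ e i)
    (hab : Dominates α β i D a b) (hf : IsGreedyAction α β S a e f)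
    (hg : Feasible α β S b e g) :
    Dominates α β i (D + g.grid - f.grid) (nextStorage α a f) (nextStorage α b g) := by
  have hβ0 : 0 < β := hα.trans_lt hαβ
  have hc := canon_isGreedyAction hα hαβ hβ ha he
  obtain ⟨-, l1, r1⟩ := (Dominates.refl α β i a).canon_step hα hαβ hβ ha he hf.1
  have hgrid : f.grid = (canon α β S i a e).grid :=
    le_antisymm (hf.2.1 _ hc.1) (hc.2.1 _ hf.1)
  have hsum := hf.2.2 _ hc.1 hgrid.ge
  rw [add_eq_add_rev i, add_eq_add_rev i] at hsum
  obtain ⟨n2, l2, r2⟩ := hab.canon_step hα hαβ hβ ha he hg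
  rw [← hgrid] at l1 r1 n2 l2 r2
  have hsum' := mul_le_mul_of_nonneg_left hsum
    (mul_nonneg (mul_nonneg hα hβ0.le) (add_nonneg zero_le_one hβ0.le))
  -- The explicit action dominates `f` with D = 0, while `f` has at least the same total storage;
  -- hence both inequalities are equalities.
  have h1 : β * (α * (β * nextStorage α a (canon α β S i a e) i +
      nextStorage α a (canon α β S i a e) i.rev)) ≤
      β * (α * (β * nextStorage α a f i + nextStorage α a f i.rev)) := by linarith
  have h2 := le_of_mul_le_mul_left h1 hβ0
  have h3 : α * β * (nextStorage α a (canon α β S i a e) i +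
      β * nextStorage α a (canon α β S i a e) i.rev) ≤
      α * β * (nextStorage α a f i + β * nextStorage α a f i.rev) := by
    have : α * (β * nextStorage α a f i + nextStorage α a f i.rev) ≤
      α * (β * nextStorage α a (canon α β S i a e) i +
        nextStorage α a (canon α β S i a e) i.rev) := by linarith
    linarith [mul_le_mul_of_nonneg_left this hβ0.le]
  exact ⟨n2, by linarith, by linarith⟩

end Greedy

/-! ### Pathwise comparison and optimality -/

section Storage

variable {Ω : Type*} {α : ℝ} {p : Policy} {E : ℕ → Ω → Fin 2 → ℝ} {k : ℕ} {s : Fin 2 → ℝ} {ω : Ω}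

theorem storage_start (α : ℝ) (p : Policy) (E : ℕ → Ω → Fin 2 → ℝ) (k : ℕ) (s : Fin 2 → ℝ)
    (ω : Ω) : storage α p E k s ω k = s := by
  cases k <;> simp [storage]

theorem storage_succ {t : ℕ} (h : k ≤ t) :
    storage α p E k s ω (t + 1) = nextStorage α (storage α p E k s ω t) (p.act E t ω) := by
  simp [storage, h]

/-- On every sample path, greedy actions dominate feasible actions. -/
theorem dominates_of_greedy {β S : ℝ} {N : ℕ} {i : Fin 2} {q : Policy} (hα : 0 ≤ α)
    (hαβ : α < β) (hβ : β ≤ 1) (hs : ∀ m, 0 ≤ s m ∧ s m ≤ S)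
    (he : ∀ t ∈ Finset.Icc k N, 0 ≤ E t ω i)
    (hp : ∀ t ∈ Finset.Icc k N,
      IsGreedyAction α β S (storage α p E k s ω t) (E t ω) (p.act E t ω))
    (hq : ∀ t ∈ Finset.Icc k N, Feasible α β S (storage α q E k s ω t) (E t ω) (q.act E t ω))
    {n : ℕ} (hkn : k ≤ n) (hn : n ≤ N + 1) :
    Dominates α β i
      (∑ t ∈ Finset.Ico k n, (q.act E t ω).grid - ∑ t ∈ Finset.Ico k n, (p.act E t ω).grid)
      (storage α p E k s ω n) (storage α q E k s ω n) ∧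
    ∀ m, 0 ≤ storage α p E k s ω n m ∧ storage α p E k s ω n m ≤ S := by
  induction n, hkn using Nat.le_induction with
  | base =>
    simp only [storage_start, Finset.Ico_self, Finset.sum_empty, sub_self]
    exact ⟨Dominates.refl _ _ _ _, hs⟩
  | succ t hkt ih =>
    obtain ⟨hd, hb⟩ := ih (by omega)
    have ht : t ∈ Finset.Icc k N := Finset.mem_Icc.2 ⟨hkt, by omega⟩
    rw [storage_succ hkt, storage_succ hkt, Finset.sum_Ico_succ_top hkt,
      Finset.sum_Ico_succ_top hkt]
    refine ⟨?_, fun m => ⟨(hp t ht).1.storage_nonneg m, (hp t ht).1.storage_le m⟩⟩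
    convert hd.greedy_step hα hαβ hβ hb (he t ht) (hp t ht) (hq t ht) using 1
    ring

variable [MeasurableSpace Ω]

theorem IsGreedy.isOptimal {μ : Measure Ω} {β S : ℝ} {N : ℕ} {i : Fin 2} (hα : 0 ≤ α)
    (hαβ : α < β) (hβ : β ≤ 1) (hs : ∀ m, 0 ≤ s m ∧ s m ≤ S) (hk : k ≤ N)
    (he : ∀ t ∈ Finset.Icc k N, ∀ᵐ ω ∂μ, 0 ≤ E t ω i) (hp : IsGreedy α β S N μ E k s p) :
    IsOptimal α β S N μ E k s p := by
  refine ⟨⟨hp.1, fun t ht => (hp.2 t ht).mono fun ω h => h.1⟩, fun q hq => ?_⟩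
  refine lintegral_mono_ae ?_
  have h1 := (Finset.eventually_all _).2 he
  have h2 := (Finset.eventually_all _).2 hp.2
  have h3 := (Finset.eventually_all _).2 hq.2
  filter_upwards [h1, h2, h3] with ω h1 h2 h3
  refine ENNReal.ofReal_le_ofReal ?_
  have := (dominates_of_greedy hα hαβ hβ hs h1 h2 h3 (n := N + 1) (by omega) le_rfl).1.nonneg
  rw [← sub_nonneg]
  exact this

end Storage

/-! ### A measurable greedy policy -/

section CanonPolicy

/-- The storage levels under the explicit greedy actions, along the net energies `f`. -/
noncomputable def canonStorage (α β S : ℝ) (i : Fin 2) (k : ℕ) (s : Fin 2 → ℝ)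
    (f : ℕ → Fin 2 → ℝ) : ℕ → Fin 2 → ℝ
  | 0 => s
  | t + 1 =>
    if k ≤ t then
      nextStorage α (canonStorage α β S i k s f t)
        (canon α β S i (canonStorage α β S i k s f t) (f t))
    else s

/-- The net energies listed by a history, indexed by slots. -/
def unhistory {t : ℕ} (h : Fin t → Fin 2 → ℝ) (n : ℕ) : Fin 2 → ℝ :=
  if hn : n - 1 < t then h ⟨n - 1, hn⟩ else 0

/-- The policy that takes the explicit greedy action in each slot. -/
noncomputable def canonPolicy (α β S : ℝ) (i : Fin 2) (k : ℕ) (s : Fin 2 → ℝ) : Policy :=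
  fun t h => canon α β S i (canonStorage α β S i k s (unhistory h) t) (unhistory h t)

variable {α β S : ℝ} {i : Fin 2} {k : ℕ} {s : Fin 2 → ℝ}

theorem measurable_unhistory {t : ℕ} (n : ℕ) :
    Measurable fun h : Fin t → Fin 2 → ℝ => unhistory h n := by
  unfold unhistory
  split_ifs
  · exact measurable_pi_apply _
  · exact measurable_const

theorem measurable_nextStorage {X : Type*} [MeasurableSpace X] {s : X → Fin 2 → ℝ} {a : X → Action}
    (hs : Measurable s) (hc : Measurable fun x => (a x).c) (hd : Measurable fun x => (a x).d) :
    Measurable fun x => nextStorage α (s x) (a x) :=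
  (hs.add (hc.const_smul α)).sub hd

theorem measurable_canonStorage {X : Type*} [MeasurableSpace X] {f : X → ℕ → Fin 2 → ℝ}
    (hf : ∀ n, Measurable fun x => f x n) (t : ℕ) :
    Measurable fun x => canonStorage α β S i k s (f x) t := by
  induction t with
  | zero => exact measurable_const
  | succ t ih =>
    simp only [canonStorage]
    split_ifs
    · have := measurable_canon α β S i ih (hf t)
      exact measurable_nextStorage ih this.2.1 this.2.2.1
    · exact measurable_const

theorem canonPolicy_measurable : (canonPolicy α β S i k s).Measurable := fun t =>
  measurable_canon α β S i (measurable_canonStorage measurable_unhistory t)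
    (measurable_unhistory t)

/-- Only past slots from k on matter, so the policy can rebuild the storage levels from the observed
history; the default values of `unhistory` play no role. -/
theorem canonStorage_congr {f g : ℕ → Fin 2 → ℝ} {t : ℕ} (h : ∀ n, k ≤ n → n < t → f n = g n) :
    canonStorage α β S i k s f t = canonStorage α β S i k s g t := by
  induction t with
  | zero => rfl
  | succ t ih =>
    simp only [canonStorage]
    split_ifs with hk
    · rw [ih fun n h1 h2 => h n h1 (by omega), h t hk (by omega)]
    · rfl

variable {Ω : Type*} {E : ℕ → Ω → Fin 2 → ℝ} {ω : Ω}

theorem unhistory_history {n t : ℕ} (hn : 1 ≤ n) (hnt : n ≤ t) :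
    unhistory (history E t ω) n = E n ω := by
  simp [unhistory, history, show n - 1 < t by omega, Nat.sub_add_cancel hn]

theorem canonPolicy_act (hk : 1 ≤ k) {t : ℕ} (hkt : k ≤ t) :
    (canonPolicy α β S i k s).act E t ω =
      canon α β S i (canonStorage α β S i k s (fun n => E n ω) t) (E t ω) := by
  unfold Policy.act canonPolicy
  rw [unhistory_history (hk.trans hkt) le_rfl,
    canonStorage_congr fun n h1 h2 => unhistory_history (hk.trans h1) h2.le]

theorem storage_canonPolicy (hk : 1 ≤ k) (t : ℕ) :
    storage α (canonPolicy α β S i k s) E k s ω t =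
      canonStorage α β S i k s (fun n => E n ω) t := by
  induction t with
  | zero => rfl
  | succ t ih =>
    simp only [storage, canonStorage]
    split_ifs with h
    · rw [ih, canonPolicy_act hk h]
    · rfl

theorem canonStorage_mem (hα : 0 ≤ α) (hαβ : α < β) (hβ : β ≤ 1)
    (hs : ∀ m, 0 ≤ s m ∧ s m ≤ S) {f : ℕ → Fin 2 → ℝ} {t : ℕ}
    (hf : ∀ n, k ≤ n → n < t → 0 ≤ f n i) (m : Fin 2) :
    0 ≤ canonStorage α β S i k s f t m ∧ canonStorage α β S i k s f t m ≤ S := by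
  induction t generalizing m with
  | zero => exact hs m
  | succ t ih =>
    simp only [canonStorage]
    split_ifs with hk
    · have h := canon_feasible hα hαβ hβ (ih fun n h1 h2 => hf n h1 (by omega))
        (hf t hk (by omega))
      exact ⟨h.storage_nonneg m, h.storage_le m⟩
    · exact hs m

theorem exists_isGreedy_exclusive [MeasurableSpace Ω] {μ : Measure Ω} {N : ℕ} (hα : 0 ≤ α)
    (hαβ : α < β) (hβ : β ≤ 1) (hs : ∀ m, 0 ≤ s m ∧ s m ≤ S) (hk : 1 ≤ k)
    (he : ∀ t ∈ Finset.Icc k N, ∀ᵐ ω ∂μ, 0 ≤ E t ω i) :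
    ∃ p : Policy, IsGreedy α β S N μ E k s p ∧
      ∀ t ∈ Finset.Icc k N, ∀ᵐ ω ∂μ, (p.act E t ω).Exclusive := by
  have he' := (Finset.eventually_all _).2 he
  have hmem : ∀ t ∈ Finset.Icc k N, ∀ᵐ ω ∂μ, 0 ≤ E t ω i ∧
      ∀ m, 0 ≤ canonStorage α β S i k s (fun n => E n ω) t m ∧
        canonStorage α β S i k s (fun n => E n ω) t m ≤ S := by
    intro t ht
    filter_upwards [he'] with ω h
    refine ⟨h t ht, canonStorage_mem hα hαβ hβ hs fun n h1 h2 => h n ?_⟩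
    rw [Finset.mem_Icc] at ht ⊢
    omega
  refine ⟨canonPolicy α β S i k s, ⟨canonPolicy_measurable, fun t ht => ?_⟩, fun t ht => ?_⟩
  · filter_upwards [hmem t ht] with ω h
    rw [storage_canonPolicy hk, canonPolicy_act hk (Finset.mem_Icc.1 ht).1]
    exact canon_isGreedyAction hα hαβ hβ h.2 h.1
  · filter_upwards [hmem t ht] with ω h
    rw [canonPolicy_act hk (Finset.mem_Icc.1 ht).1]
    exact canon_exclusive hα hαβ (h.2 _).2

end CanonPolicy

end EnergyCoop

theorem mainTheorem3 {Ω : Type*} [MeasurableSpace Ω] (μ : Measure Ω) [IsProbabilityMeasure μ]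
    (α β Smax : ℝ) (hα : 0 ≤ α) (hαβ : α < β) (hβ : β ≤ 1) (hS : 0 ≤ Smax)
    (N : ℕ) (E : ℕ → Ω → Fin 2 → ℝ) (hE : ∀ t, Measurable (E t))
    (hpos : (∀ t ∈ Finset.Icc 1 N, ∀ᵐ ω ∂μ, 0 ≤ E t ω 0) ∨
      (∀ t ∈ Finset.Icc 1 N, ∀ᵐ ω ∂μ, 0 ≤ E t ω 1))
    (k : ℕ) (hk : k ∈ Finset.Icc 1 N)
    (s : Fin 2 → ℝ) (hs : ∀ i, 0 ≤ s i ∧ s i ≤ Smax) :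
    (∃ p : EnergyCoop.Policy, EnergyCoop.IsGreedy α β Smax N μ E k s p ∧
      ∀ t ∈ Finset.Icc k N, ∀ᵐ ω ∂μ, (p.act E t ω).Exclusive) ∧
    (∀ p : EnergyCoop.Policy, EnergyCoop.IsGreedy α β Smax N μ E k s p →
      EnergyCoop.IsOptimal α β Smax N μ E k s p) := by
  obtain ⟨hk1, hkN⟩ := Finset.mem_Icc.1 hk
  obtain ⟨i, hi⟩ : ∃ i : Fin 2, ∀ t ∈ Finset.Icc k N, ∀ᵐ ω ∂μ, 0 ≤ E t ω i :=
    hpos.elim (fun h => ⟨0, fun t ht => h t (Finset.Icc_subset_Icc_left hk1 ht)⟩)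
      fun h => ⟨1, fun t ht => h t (Finset.Icc_subset_Icc_left hk1 ht)⟩
  exact ⟨EnergyCoop.exists_isGreedy_exclusive hα hαβ hβ hs hk1 hi,
    fun p hp => hp.isOptimal hα hαβ hβ hs hkN hi⟩
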